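/- Let $\alpha,\epsilon>0$ be real numbers. Then there is a natural number $N_0=N_0(\alpha,\epsilon)$ such that the following holds. Let $G$ be a finite abelian group of odd order $N>N_0$ and let $A\subseteq G$ satisfy $|A|=\alpha N$. Then there is $d\in G$, $d\neq 0$, such that $A$ contains at least $(\alpha^3-\epsilon)N$ three-term arithmetic progressions with common difference $d$, that is, $$\#\{x\in G : x\in A,\ x+d\in A,\ x+2d\in A\}\ \ge\ (\alpha^3-\epsilon)N .$$ -/

import Mathlib

/-- The number `P(A; d)` of three-term arithmetic progressions `(x, x + d, x + 2d)` with common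
difference `d` all of whose terms lie in `A`. A progression is an ordered triple, so it is
counted once for each first term `x`. -/
def numThreeAP {G : Type*} [AddCommGroup G] [DecidableEq G] (A : Finset G) (d : G) : ℕ :=
  (A.filter (fun x => x + d ∈ A ∧ x + 2 • d ∈ A)).card

/-!
Weight the common difference `d` by a probability density `W` with nonnegative Fourier
coefficients and bounded `W 0`, and let `Λ(f, g, h)` be the resulting average of
`f(x) g(x + d) h(x + 2d)`, with `f` the indicator function of `A`. Only the middle function is
regularised, along densities `β`, `W`, `β'` of finer and finer scale supplied by an energy increment
argument. Replacing it by its smoothing `f * β'` costs little, since a bound on the Fourier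
coefficients of the middle function alone controls `Λ`, without any need to invert doubling.
Passing from `f * β'` to `g = f * β` costs little, since the two are close in `L²`. Now `√g` is
almost invariant under the translations weighted by `W`, so `Λ(u, g, u)` with `u = f - α` is up to
a small error the positive definite form `𝔼 W(d) (u√g)(x) (u√g)(x + 2d)`. Expanding `f = α + u` in
the outer places then gives `Λ(f, g, f) ≥ 2α·α² - α³ - o(1)`. The difference `d = 0` has weight at
most `W 0 / N`, so some nonzero `d` is as popular as the average.
-/

open Finset
open scoped BigOperators ComplexConjugate ComplexOrder

section Fourier

variable {G : Type*} [AddCommGroup G] [Fintype G]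

/-- The normalised Fourier coefficient `𝔼 x, f x * conj (ψ x)`, written with `ψ (-x)` in place of
`conj (ψ x)` so that characters multiply by `AddChar.map_add_eq_mul`. -/
noncomputable def fourierCoef (f : G → ℝ) (ψ : AddChar G ℂ) : ℂ := 𝔼 x, (f x : ℂ) * ψ (-x)

/-- The normalised cross-correlation of two functions. Smoothing `f` at the scale of an even
density `β` means passing to `crossCorr β f`, which is the convolution of `β` and `f`. -/
noncomputable def crossCorr (f g : G → ℝ) (d : G) : ℝ := 𝔼 x, f x * g (x + d)

lemma expect_translate {M : Type*} [AddCommMonoid M] [Module ℚ≥0 M] (f : G → M) (a : G) :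
    𝔼 x, f (x + a) = 𝔼 x, f x :=
  Fintype.expect_equiv (Equiv.addRight a) _ _ fun _ => rfl

lemma expect_expect_mul_translate {R : Type*} [CommSemiring R] [Algebra ℚ≥0 R] (f g : G → R) :
    𝔼 d, 𝔼 x, f x * g (x + d) = (𝔼 x, f x) * 𝔼 x, g x := by
  rw [expect_comm, expect_mul]
  refine expect_congr rfl fun x _ => ?_
  simp_rw [add_comm x, ← mul_expect, expect_translate]

lemma expect_crossCorr (f g : G → ℝ) : 𝔼 d, crossCorr f g d = (𝔼 x, f x) * 𝔼 x, g x :=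
  expect_expect_mul_translate f g

lemma fourierCoef_zero (f : G → ℝ) : fourierCoef f 0 = ((𝔼 x, f x : ℝ) : ℂ) := by
  simp [fourierCoef, Complex.ofReal_expect]

lemma fourierCoef_sub (f g : G → ℝ) (ψ : AddChar G ℂ) :
    fourierCoef (fun x => f x - g x) ψ = fourierCoef f ψ - fourierCoef g ψ := by
  simp only [fourierCoef, ← expect_sub_distrib, Complex.ofReal_sub, sub_mul]

lemma fourierCoef_neg (f : G → ℝ) (ψ : AddChar G ℂ) :
    fourierCoef f (-ψ) = conj (fourierCoef f ψ) := by
  simp [fourierCoef, map_expect, AddChar.map_neg_eq_conj, AddChar.neg_apply]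

lemma norm_fourierCoef_le (f : G → ℝ) (ψ : AddChar G ℂ) : ‖fourierCoef f ψ‖ ≤ 𝔼 x, |f x| :=
  (RCLike.norm_expect_le (K := ℂ)).trans_eq (by simp [AddChar.norm_apply])

lemma fourierCoef_crossCorr (f g : G → ℝ) (ψ : AddChar G ℂ) :
    fourierCoef (crossCorr f g) ψ = conj (fourierCoef f ψ) * fourierCoef g ψ := by
  rw [← fourierCoef_neg, fourierCoef, fourierCoef, fourierCoef, ← expect_expect_mul_translate]
  refine expect_congr rfl fun d _ => ?_
  rw [crossCorr, Complex.ofReal_expect, expect_mul]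
  refine expect_congr rfl fun x _ => ?_
  have hψ : ψ (-d) = (-ψ) (-x) * ψ (-(x + d)) := by
    rw [AddChar.neg_apply, neg_neg, ← AddChar.map_add_eq_mul]
    congr 1
    abel
  rw [hψ]
  push_cast
  ring

lemma sum_fourierCoef_mul (f : G → ℝ) (x : G) : ∑ ψ, fourierCoef f ψ * ψ x = f x := by
  classical
  have hterm (ψ : AddChar G ℂ) : fourierCoef f ψ * ψ x = 𝔼 y, f y * ψ (x - y) := by
    rw [fourierCoef, expect_mul]
    refine expect_congr rfl fun y _ => ?_
    rw [sub_eq_neg_add, AddChar.map_add_eq_mul, mul_assoc]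
  have hN : (Fintype.card G : ℂ) ≠ 0 := by simp
  simp_rw [hterm, ← expect_sum_comm, ← mul_sum, AddChar.sum_apply_eq_ite, sub_eq_zero, mul_ite,
    mul_zero]
  rw [Fintype.expect_eq_sum_div_card, sum_ite_eq, if_pos (mem_univ x), mul_div_cancel_right₀ _ hN]

lemma crossCorr_eq_sum (f g : G → ℝ) (d : G) :
    (crossCorr f g d : ℂ) = ∑ ψ, conj (fourierCoef f ψ) * fourierCoef g ψ * ψ d := by
  simp_rw [← fourierCoef_crossCorr, sum_fourierCoef_mul]

lemma sum_norm_sq_fourierCoef (f : G → ℝ) : ∑ ψ, ‖fourierCoef f ψ‖ ^ 2 = 𝔼 x, f x ^ 2 := by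
  have h := crossCorr_eq_sum f f 0
  simp only [AddChar.map_zero_eq_one, mul_one, Complex.conj_mul', crossCorr, add_zero] at h
  simp_rw [sq (f _)]
  exact_mod_cast h.symm

lemma expect_mul_character (f : G → ℝ) (ψ : AddChar G ℂ) :
    𝔼 d, (f d : ℂ) * ψ d = fourierCoef f (-ψ) := by
  simp [fourierCoef, AddChar.neg_apply]

lemma expect_mul_crossCorr (W f g : G → ℝ) (n : ℕ) :
    ((𝔼 d, W d * crossCorr f g (n • d) : ℝ) : ℂ) =
      ∑ ψ, conj (fourierCoef f ψ) * fourierCoef g ψ * fourierCoef W (-(n • ψ)) := by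
  simp_rw [Complex.ofReal_expect, Complex.ofReal_mul, crossCorr_eq_sum, mul_sum, expect_sum_comm,
    ← expect_mul_character, mul_expect, AddChar.map_nsmul_eq_pow, AddChar.nsmul_apply]
  exact sum_congr rfl fun ψ _ => expect_congr rfl fun d _ => by ring

end Fourier

section UniformDensity

variable {X : Type*} [Fintype X] {P : Finset X}

open scoped Classical in
/-- The density, relative to the uniform measure on `X`, of the uniform measure on `P`. -/
noncomputable def uniformDensity (P : Finset X) (x : X) : ℝ :=
  if x ∈ P then Fintype.card X / #P else 0

lemma uniformDensity_nonneg (P : Finset X) (x : X) : 0 ≤ uniformDensity P x := by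
  unfold uniformDensity
  positivity

lemma uniformDensity_of_mem {x : X} (hx : x ∈ P) : uniformDensity P x = Fintype.card X / #P :=
  if_pos hx

lemma mem_of_uniformDensity_ne_zero {x : X} (hx : uniformDensity P x ≠ 0) : x ∈ P := by
  by_contra h
  exact hx (if_neg h)

lemma expect_uniformDensity_mul (hP : P.Nonempty) (f : X → ℝ) :
    𝔼 x, uniformDensity P x * f x = 𝔼 x ∈ P, f x := by
  classical
  have hX : (Fintype.card X : ℝ) ≠ 0 := by
    exact_mod_cast (hP.card_pos.trans_le (card_le_univ P)).ne'
  rw [Fintype.expect_eq_sum_div_card, expect_eq_sum_div_card]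
  simp_rw [uniformDensity, ite_mul, zero_mul, sum_ite_mem, univ_inter, ← mul_sum]
  field_simp

lemma expect_uniformDensity (hP : P.Nonempty) : 𝔼 x, uniformDensity P x = 1 := by
  simpa [hP] using expect_uniformDensity_mul hP fun _ => 1

lemma expect_uniformDensity_sq (hP : P.Nonempty) :
    𝔼 x, uniformDensity P x * uniformDensity P x = Fintype.card X / #P := by
  rw [expect_uniformDensity_mul hP, expect_congr rfl fun x hx => uniformDensity_of_mem hx,
    expect_const hP]

end UniformDensity

lemma exists_finite_coloring_dist_le (X : Type*) [PseudoMetricSpace X] [CompactSpace X] {ρ : ℝ}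
    (hρ : 0 < ρ) : ∃ (C : ℕ) (c : X → Fin C), ∀ x y, c x = c y → dist x y ≤ ρ := by
  obtain ⟨t, -, ht, hcover⟩ :=
    (isCompact_univ : IsCompact (Set.univ : Set X)).finite_cover_balls (half_pos hρ)
  have := ht.fintype
  have hnear (x : X) : ∃ i : t, dist x i < ρ / 2 := by
    obtain ⟨i, hi, hx⟩ := Set.mem_iUnion₂.1 (hcover (Set.mem_univ x))
    exact ⟨⟨i, hi⟩, hx⟩
  choose center hcenter using hnear
  refine ⟨Fintype.card t, fun x => Fintype.equivFin t (center x), fun x y h => ?_⟩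
  have hy := hcenter y
  rw [← (Fintype.equivFin t).injective h] at hy
  linarith [dist_triangle_right x y (center x), hcenter x]

section PosDefDensity

variable {G : Type*} [AddCommGroup G] [Fintype G]

/-- A probability density on `G` (relative to the uniform measure) whose Fourier coefficients are
nonnegative reals. Such densities play the role of normalised Bohr sets: as weights on the common
difference, and as smoothing kernels. -/
structure IsPosDefDensity (β : G → ℝ) : Prop where
  nonneg : ∀ x, 0 ≤ β x
  expect_eq_one : 𝔼 x, β x = 1
  fourierCoef_nonneg : ∀ ψ, 0 ≤ fourierCoef β ψ

namespace IsPosDefDensity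

variable {β : G → ℝ}

lemma fourierCoef_eq_norm (hβ : IsPosDefDensity β) (ψ : AddChar G ℂ) :
    fourierCoef β ψ = (‖fourierCoef β ψ‖ : ℂ) :=
  Complex.eq_coe_norm_of_nonneg (hβ.fourierCoef_nonneg ψ)

lemma fourierCoef_neg (hβ : IsPosDefDensity β) (ψ : AddChar G ℂ) :
    fourierCoef β (-ψ) = (‖fourierCoef β ψ‖ : ℂ) := by
  rw [_root_.fourierCoef_neg, hβ.fourierCoef_eq_norm, Complex.conj_ofReal, Complex.norm_real,
    norm_norm]

lemma norm_fourierCoef_zero (hβ : IsPosDefDensity β) : ‖fourierCoef β 0‖ = 1 := by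
  simp [fourierCoef_zero, hβ.expect_eq_one]

lemma norm_fourierCoef_le_one (hβ : IsPosDefDensity β) (ψ : AddChar G ℂ) :
    ‖fourierCoef β ψ‖ ≤ 1 := by
  simpa only [abs_of_nonneg (hβ.nonneg _), hβ.expect_eq_one] using norm_fourierCoef_le β ψ

lemma sum_norm_fourierCoef (hβ : IsPosDefDensity β) : ∑ ψ, ‖fourierCoef β ψ‖ = β 0 := by
  have h := sum_fourierCoef_mul β 0
  simp only [AddChar.map_zero_eq_one, mul_one] at h
  rw [sum_congr rfl fun ψ _ => hβ.fourierCoef_eq_norm ψ] at h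
  exact_mod_cast h

lemma one_le_apply_zero (hβ : IsPosDefDensity β) : 1 ≤ β 0 := by
  rw [← hβ.norm_fourierCoef_zero, ← hβ.sum_norm_fourierCoef]
  exact single_le_sum (f := fun ψ => ‖fourierCoef β ψ‖) (fun ψ _ => norm_nonneg _) (mem_univ 0)

lemma fourierCoef_crossCorr (hβ : IsPosDefDensity β) (f : G → ℝ) (ψ : AddChar G ℂ) :
    fourierCoef (crossCorr β f) ψ = ‖fourierCoef β ψ‖ * fourierCoef f ψ := by
  rw [_root_.fourierCoef_crossCorr, ← _root_.fourierCoef_neg, hβ.fourierCoef_neg]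

lemma crossCorr_mem_Icc (hβ : IsPosDefDensity β) {f : G → ℝ} {a b : ℝ}
    (hf : ∀ x, f x ∈ Set.Icc a b) (x : G) : crossCorr β f x ∈ Set.Icc a b := by
  have hconst (c : ℝ) : 𝔼 y, β y * c = c := by rw [← expect_mul, hβ.expect_eq_one, one_mul]
  constructor
  · exact (hconst a).symm.trans_le <| expect_le_expect fun y _ =>
      mul_le_mul_of_nonneg_left (hf _).1 (hβ.nonneg y)
  · exact (expect_le_expect fun y _ =>
      mul_le_mul_of_nonneg_left (hf _).2 (hβ.nonneg y)).trans_eq (hconst b)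

end IsPosDefDensity

lemma isPosDefDensity_crossCorr_self {p : G → ℝ} (hp : ∀ x, 0 ≤ p x) (hp1 : 𝔼 x, p x = 1) :
    IsPosDefDensity (crossCorr p p) where
  nonneg d := expect_nonneg fun x _ => mul_nonneg (hp x) (hp _)
  expect_eq_one := by rw [expect_crossCorr, hp1, one_mul]
  fourierCoef_nonneg ψ := by
    rw [fourierCoef_crossCorr, Complex.conj_mul']
    exact_mod_cast sq_nonneg ‖fourierCoef p ψ‖

lemma one_sub_le_norm_fourierCoef {p : G → ℝ} (hp : ∀ x, 0 ≤ p x) (hp1 : 𝔼 x, p x = 1)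
    {ψ : AddChar G ℂ} {y : G} {ρ : ℝ} (hψ : ∀ x, p x ≠ 0 → ‖ψ x - ψ y‖ ≤ ρ) :
    1 - ρ ≤ ‖fourierCoef p ψ‖ := by
  have hdiff : ψ (-y) - fourierCoef p ψ = 𝔼 x, (p x : ℂ) * (ψ (-y) - ψ (-x)) := by
    simp_rw [mul_sub, expect_sub_distrib, ← expect_mul, ← Complex.ofReal_expect, hp1,
      Complex.ofReal_one, one_mul, fourierCoef]
  have hterm (x : G) : ‖(p x : ℂ) * (ψ (-y) - ψ (-x))‖ ≤ p x * ρ := by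
    rw [norm_mul, Complex.norm_real, Real.norm_of_nonneg (hp x), AddChar.map_neg_eq_conj,
      AddChar.map_neg_eq_conj, ← map_sub, RCLike.norm_conj, norm_sub_rev]
    rcases eq_or_ne (p x) 0 with hx | hx
    · simp only [hx, zero_mul, le_refl]
    · exact mul_le_mul_of_nonneg_left (hψ x hx) (hp x)
  have hsmall : ‖ψ (-y) - fourierCoef p ψ‖ ≤ ρ :=
    calc ‖ψ (-y) - fourierCoef p ψ‖ ≤ 𝔼 x, ‖(p x : ℂ) * (ψ (-y) - ψ (-x))‖ :=
          hdiff ▸ RCLike.norm_expect_le (K := ℂ)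
      _ ≤ 𝔼 x, p x * ρ := expect_le_expect fun x _ => hterm x
      _ = ρ := by rw [← expect_mul, hp1, one_mul]
  linarith [norm_sub_norm_le (ψ (-y)) (fourierCoef p ψ), AddChar.norm_apply ψ (-y)]

lemma exists_large_set_with_almost_constant_characters {ρ : ℝ} (hρ : 0 < ρ) :
    ∃ C : ℕ, ∀ (G : Type*) [AddCommGroup G] [Fintype G] (S : Finset (AddChar G ℂ)),
      ∃ P : Finset G, Fintype.card G ≤ C ^ #S * #P ∧
        ∀ γ ∈ S, ∀ x ∈ P, ∀ y ∈ P, ‖γ x - γ y‖ ≤ ρ := by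
  classical
  obtain ⟨C, c, hc⟩ := exists_finite_coloring_dist_le (Metric.sphere (0 : ℂ) 1) hρ
  refine ⟨C, fun G _ _ S => ?_⟩
  let value (γ : AddChar G ℂ) (x : G) : Metric.sphere (0 : ℂ) 1 :=
    ⟨γ x, mem_sphere_zero_iff_norm.2 (AddChar.norm_apply γ x)⟩
  have hC : Nonempty (Fin C) := ⟨c (value 0 0)⟩
  have hCpos : 0 < (C : ℝ) ^ #S := by
    have := Fin.pos_iff_nonempty.2 hC
    positivity
  obtain ⟨colors, hcolors⟩ := Fintype.exists_le_card_fiber_of_nsmul_le_card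
    (fun (x : G) (γ : S) => c (value γ x)) (b := (Fintype.card G / C ^ #S : ℝ)) (by
      simp [nsmul_eq_mul, mul_div_cancel₀ _ hCpos.ne'])
  refine ⟨univ.filter fun x => (fun γ : S => c (value γ x)) = colors, ?_, fun γ hγ x hx y hy => ?_⟩
  · rw [div_le_iff₀' hCpos] at hcolors
    exact_mod_cast hcolors
  · rw [mem_filter_univ] at hx hy
    rw [← dist_eq_norm]
    exact hc (value γ x) (value γ y) (congrFun (hx.trans hy.symm) ⟨γ, hγ⟩)

lemma exists_isPosDefDensity {ρ : ℝ} (hρ : 0 < ρ) (n : ℕ) :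
    ∃ M : ℝ, ∀ (G : Type*) [AddCommGroup G] [Fintype G] (S : Finset (AddChar G ℂ)), #S ≤ n →
      ∃ β : G → ℝ, IsPosDefDensity β ∧ β 0 ≤ M ∧ ∀ γ ∈ S, 1 - ‖fourierCoef β γ‖ ≤ 2 * ρ := by
  obtain ⟨C, hC⟩ := exists_large_set_with_almost_constant_characters hρ
  refine ⟨max (C : ℝ) 1 ^ n, fun G _ _ S hS => ?_⟩
  obtain ⟨P, hcard, hP⟩ := hC G S
  have hPne : P.Nonempty := by
    rw [nonempty_iff_ne_empty]
    rintro rfl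
    simp at hcard
  have ⟨y, hy⟩ := hPne
  refine ⟨_, isPosDefDensity_crossCorr_self (uniformDensity_nonneg P) (expect_uniformDensity hPne),
    ?_, fun γ hγ => ?_⟩
  · simp only [crossCorr, add_zero]
    rw [expect_uniformDensity_sq hPne, div_le_iff₀ (by exact_mod_cast hPne.card_pos)]
    calc (Fintype.card G : ℝ) ≤ C ^ #S * #P := by exact_mod_cast hcard
      _ ≤ max (C : ℝ) 1 ^ #S * #P := by gcongr; exact le_max_left _ _
      _ ≤ max (C : ℝ) 1 ^ n * #P := by gcongr; exact le_max_right _ _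
  · have hγP := one_sub_le_norm_fourierCoef (uniformDensity_nonneg P) (expect_uniformDensity hPne)
      fun x hx => hP γ hγ x (mem_of_uniformDensity_ne_zero hx) y hy
    rw [fourierCoef_crossCorr, Complex.conj_mul', ← Complex.ofReal_pow, Complex.norm_real,
      Real.norm_of_nonneg (sq_nonneg _)]
    nlinarith [sq_nonneg (‖fourierCoef (uniformDensity P) γ‖ - 1)]

end PosDefDensity

section Refinement

/-- `β'` is a finer scale than `β` for `f`: its Fourier coefficients are close to `1` wherever that
of `β` or of `f` is not small, with a tolerance for `f` that improves as `β` gets more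
concentrated. -/
def IsRefinement {G : Type*} [AddCommGroup G] [Fintype G] (δ : ℝ) (f β β' : G → ℝ) : Prop :=
  ∀ ψ, (‖fourierCoef β ψ‖ + β 0 * ‖fourierCoef f ψ‖) * (1 - ‖fourierCoef β' ψ‖) ≤ δ

namespace IsRefinement

variable {G : Type*} [AddCommGroup G] [Fintype G] {δ : ℝ} {f β β' : G → ℝ}

lemma norm_fourierCoef_mul_le (h : IsRefinement δ f β β') (hβ : IsPosDefDensity β)
    (hβ' : IsPosDefDensity β') (ψ : AddChar G ℂ) :
    ‖fourierCoef β ψ‖ * (1 - ‖fourierCoef β' ψ‖) ≤ δ := by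
  have hf : 0 ≤ β 0 * ‖fourierCoef f ψ‖ := mul_nonneg (hβ.nonneg 0) (norm_nonneg _)
  exact (mul_le_mul_of_nonneg_right (le_add_of_nonneg_right hf)
    (sub_nonneg.2 (hβ'.norm_fourierCoef_le_one ψ))).trans (h ψ)

lemma apply_zero_mul_le (h : IsRefinement δ f β β') (hβ' : IsPosDefDensity β')
    (ψ : AddChar G ℂ) : β 0 * (‖fourierCoef f ψ‖ * (1 - ‖fourierCoef β' ψ‖)) ≤ δ := by
  rw [← mul_assoc]
  exact (mul_le_mul_of_nonneg_right (le_add_of_nonneg_left (norm_nonneg _))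
    (sub_nonneg.2 (hβ'.norm_fourierCoef_le_one ψ))).trans (h ψ)

lemma norm_fourierCoef_sub_le (h : IsRefinement δ f β β') (hβ : IsPosDefDensity β)
    (hβ' : IsPosDefDensity β') (ψ : AddChar G ℂ) :
    ‖fourierCoef β ψ‖ - δ ≤ ‖fourierCoef β' ψ‖ := by
  nlinarith [h.norm_fourierCoef_mul_le hβ hβ' ψ,
    mul_le_mul_of_nonneg_right (hβ.norm_fourierCoef_le_one ψ) (norm_nonneg (fourierCoef β' ψ))]

end IsRefinement

lemma card_filter_le_mul_sq_le_sum_sq {ι : Type*} (s : Finset ι) {a : ι → ℝ} {δ : ℝ}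
    (hδ : 0 ≤ δ) : #{i ∈ s | δ ≤ a i} * δ ^ 2 ≤ ∑ i ∈ s, a i ^ 2 := by
  rw [← nsmul_eq_mul]
  calc #{i ∈ s | δ ≤ a i} • δ ^ 2 ≤ ∑ i ∈ s with δ ≤ a i, a i ^ 2 :=
        card_nsmul_le_sum _ _ _ fun i hi => pow_le_pow_left₀ hδ (mem_filter.1 hi).2 2
    _ ≤ ∑ i ∈ s, a i ^ 2 :=
        sum_le_sum_of_subset_of_nonneg (filter_subset _ _) fun _ _ _ => sq_nonneg _

lemma IsPosDefDensity.sum_refinement_weight_sq_le {G : Type*} [AddCommGroup G] [Fintype G]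
    {f β : G → ℝ} (hβ : IsPosDefDensity β) (hf : 𝔼 x, f x ^ 2 ≤ 1) :
    ∑ ψ, (‖fourierCoef β ψ‖ + β 0 * ‖fourierCoef f ψ‖) ^ 2 ≤ 2 * (β 0 + β 0 ^ 2) :=
  calc ∑ ψ, (‖fourierCoef β ψ‖ + β 0 * ‖fourierCoef f ψ‖) ^ 2
      ≤ ∑ ψ, 2 * (‖fourierCoef β ψ‖ + β 0 ^ 2 * ‖fourierCoef f ψ‖ ^ 2) := by
        refine sum_le_sum fun ψ _ => add_sq_le.trans ?_
        rw [mul_pow]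
        gcongr
        exact pow_le_of_le_one (norm_nonneg _) (hβ.norm_fourierCoef_le_one ψ) two_ne_zero
    _ = 2 * (β 0 + β 0 ^ 2 * 𝔼 x, f x ^ 2) := by
        rw [← mul_sum, sum_add_distrib, ← mul_sum, hβ.sum_norm_fourierCoef,
          sum_norm_sq_fourierCoef]
    _ ≤ 2 * (β 0 + β 0 ^ 2) := by
        gcongr
        exact mul_le_of_le_one_right (sq_nonneg _) hf

lemma exists_isRefinement {δ : ℝ} (hδ : 0 < δ) (M : ℝ) :
    ∃ M' : ℝ, ∀ (G : Type*) [AddCommGroup G] [Fintype G] (f β : G → ℝ),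
      (∀ x, |f x| ≤ 1) → IsPosDefDensity β → β 0 ≤ M →
        ∃ β' : G → ℝ, IsPosDefDensity β' ∧ β' 0 ≤ M' ∧ IsRefinement δ f β β' := by
  classical
  set m := max M 1
  have hm : 0 < m := lt_max_of_lt_right one_pos
  obtain ⟨M', hM'⟩ := exists_isPosDefDensity (show 0 < δ / (4 * m) by positivity)
    ⌊2 * (m + m ^ 2) / δ ^ 2⌋₊
  refine ⟨M', fun G _ _ f β hf hβ hβM => ?_⟩
  have hβm : β 0 ≤ m := hβM.trans (le_max_left M 1)
  have hβ0 : 0 ≤ β 0 := hβ.nonneg 0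
  set a : AddChar G ℂ → ℝ := fun ψ => ‖fourierCoef β ψ‖ + β 0 * ‖fourierCoef f ψ‖
  have ha (ψ) : a ψ ≤ 2 * m := by
    have hfψ : ‖fourierCoef f ψ‖ ≤ 1 :=
      (norm_fourierCoef_le f ψ).trans (expect_le univ_nonempty fun x _ => hf x)
    nlinarith [hβ.norm_fourierCoef_le_one ψ, le_max_right M 1]
  have hcard : #{ψ | δ ≤ a ψ} ≤ ⌊2 * (m + m ^ 2) / δ ^ 2⌋₊ := by
    refine Nat.le_floor ((le_div_iff₀ (by positivity)).2 ?_)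
    calc #{ψ | δ ≤ a ψ} * δ ^ 2 ≤ ∑ ψ, a ψ ^ 2 := card_filter_le_mul_sq_le_sum_sq univ hδ.le
      _ ≤ 2 * (β 0 + β 0 ^ 2) := hβ.sum_refinement_weight_sq_le <|
          expect_le univ_nonempty fun x _ => (sq_le_one_iff_abs_le_one _).2 (hf x)
      _ ≤ 2 * (m + m ^ 2) := by gcongr
  obtain ⟨β', hβ', hβ'M, hβ'S⟩ := hM' G {ψ | δ ≤ a ψ} hcard
  refine ⟨β', hβ', hβ'M, fun ψ => ?_⟩
  have hψ : 0 ≤ 1 - ‖fourierCoef β' ψ‖ := sub_nonneg.2 (hβ'.norm_fourierCoef_le_one ψ)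
  rcases le_or_gt δ (a ψ) with hlarge | hsmall
  · calc a ψ * (1 - ‖fourierCoef β' ψ‖) ≤ 2 * m * (2 * (δ / (4 * m))) :=
          mul_le_mul (ha ψ) (hβ'S ψ ((mem_filter_univ ψ).2 hlarge)) hψ (by positivity)
      _ = δ := by field_simp; ring
  · calc a ψ * (1 - ‖fourierCoef β' ψ‖) ≤ δ * 1 :=
          mul_le_mul hsmall.le (sub_le_self _ (norm_nonneg _)) hψ hδ.le
      _ = δ := mul_one δ

lemma exists_seq_of_forall_exists_succ {X : ℕ → Type*} {R : ∀ n, X n → X (n + 1) → Prop} (x₀ : X 0)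
    (h : ∀ n x, ∃ y, R n x y) : ∃ x : ∀ n, X n, x 0 = x₀ ∧ ∀ n, R n (x n) (x (n + 1)) := by
  choose next hnext using h
  exact ⟨fun n => n.rec x₀ next, rfl, fun n => hnext n _⟩

lemma exists_refining_sequence {δ : ℝ} (hδ : 0 < δ) :
    ∃ M : ℕ → ℝ, ∀ (G : Type*) [AddCommGroup G] [Fintype G] (f : G → ℝ), (∀ x, |f x| ≤ 1) →
      ∃ β : ℕ → G → ℝ, ∀ n,
        IsPosDefDensity (β n) ∧ β n 0 ≤ M n ∧ IsRefinement δ f (β n) (β (n + 1)) := by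
  obtain ⟨M₀, hM₀⟩ := exists_isPosDefDensity one_pos 0
  obtain ⟨M, rfl, hM⟩ := exists_seq_of_forall_exists_succ M₀ fun _ => exists_isRefinement hδ
  refine ⟨M, fun G _ _ f hf => ?_⟩
  obtain ⟨β₀, hβ₀, hβ₀M, -⟩ := hM₀ G ∅ card_empty.le
  have hstep (n : ℕ) (β : {β : G → ℝ // IsPosDefDensity β ∧ β 0 ≤ M n}) :
      ∃ β' : {β : G → ℝ // IsPosDefDensity β ∧ β 0 ≤ M (n + 1)}, IsRefinement δ f β β' := by
    obtain ⟨β', hβ', hβ'M, hββ'⟩ := hM n G f β hf β.2.1 β.2.2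
    exact ⟨⟨β', hβ', hβ'M⟩, hββ'⟩
  obtain ⟨β, -, hβ⟩ := exists_seq_of_forall_exists_succ ⟨β₀, hβ₀, hβ₀M⟩ hstep
  exact ⟨fun n => β n, fun n => ⟨(β n).2.1, (β n).2.2, hβ n⟩⟩

lemma exists_weighted_sum_sq_sub_le {ι : Type*} {s : Finset ι} {c : ι → ℝ} {b : ℕ → ι → ℝ}
    {δ : ℝ} {K : ℕ} (hK : 0 < K) (hδ : 0 ≤ δ) (hc : ∀ i, 0 ≤ c i) (hc1 : ∑ i ∈ s, c i ≤ 1)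
    (hb : ∀ k i, b k i ∈ Set.Icc 0 1) (hmono : ∀ k i, b k i - δ ≤ b (k + 1) i) :
    ∃ k < K, ∑ i ∈ s, c i * (b (k + 1) i - b k i) ^ 2 ≤ 1 / K + 2 * δ := by
  set energy : ℕ → ℝ := fun k => ∑ i ∈ s, c i * b k i ^ 2
  have henergy (k : ℕ) : energy k ∈ Set.Icc 0 1 := by
    refine ⟨sum_nonneg fun i _ => mul_nonneg (hc i) (sq_nonneg _), hc1.trans' ?_⟩
    exact sum_le_sum fun i _ => mul_le_of_le_one_right (hc i) (pow_le_one₀ (hb k i).1 (hb k i).2)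
  have hincrement (k : ℕ) :
      ∑ i ∈ s, c i * (b (k + 1) i - b k i) ^ 2 ≤ energy (k + 1) - energy k + 2 * δ := by
    have hpointwise (i : ι) :
        (b (k + 1) i - b k i) ^ 2 ≤ b (k + 1) i ^ 2 - b k i ^ 2 + 2 * δ := by
      nlinarith [hmono k i, (hb k i).1, (hb k i).2]
    calc ∑ i ∈ s, c i * (b (k + 1) i - b k i) ^ 2
        ≤ ∑ i ∈ s, c i * (b (k + 1) i ^ 2 - b k i ^ 2 + 2 * δ) :=
          sum_le_sum fun i _ => mul_le_mul_of_nonneg_left (hpointwise i) (hc i)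
      _ = energy (k + 1) - energy k + (∑ i ∈ s, c i) * (2 * δ) := by
          simp_rw [energy, mul_add, mul_sub, sum_add_distrib, sum_sub_distrib, sum_mul]
      _ ≤ energy (k + 1) - energy k + 2 * δ := by
          linarith [mul_le_of_le_one_left (show 0 ≤ 2 * δ by positivity) hc1]
  have htotal : ∑ k ∈ range K, ∑ i ∈ s, c i * (b (k + 1) i - b k i) ^ 2 ≤
      ∑ _k ∈ range K, (1 / K + 2 * δ) :=
    calc ∑ k ∈ range K, ∑ i ∈ s, c i * (b (k + 1) i - b k i) ^ 2
        ≤ ∑ k ∈ range K, (energy (k + 1) - energy k + 2 * δ) :=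
          sum_le_sum fun k _ => hincrement k
      _ = energy K - energy 0 + K * (2 * δ) := by
          rw [sum_add_distrib, sum_range_sub, sum_const, card_range, nsmul_eq_mul]
      _ ≤ 1 + K * (2 * δ) := by linarith [(henergy K).2, (henergy 0).1]
      _ = ∑ _k ∈ range K, (1 / K + 2 * δ) := by
          rw [sum_const, card_range, nsmul_eq_mul]
          field_simp
  obtain ⟨k, hk, hle⟩ := exists_le_of_sum_le (nonempty_range_iff.2 hK.ne') htotal
  exact ⟨k, mem_range.1 hk, hle⟩

end Refinement

section WeightedAverages

variable {D X : Type*} [Fintype D] [Fintype X] {W : D → ℝ}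

/-- The average of `F d x` over all `x`, and over `d` with weight `W`. -/
noncomputable def weightedAvg (W : D → ℝ) (F : D → X → ℝ) : ℝ := 𝔼 d, W d * 𝔼 x, F d x

lemma weightedAvg_add (W : D → ℝ) (F F' : D → X → ℝ) :
    weightedAvg W (fun d x => F d x + F' d x) = weightedAvg W F + weightedAvg W F' := by
  simp only [weightedAvg, expect_add_distrib, mul_add]

lemma weightedAvg_sub (W : D → ℝ) (F F' : D → X → ℝ) :
    weightedAvg W (fun d x => F d x - F' d x) = weightedAvg W F - weightedAvg W F' := by
  simp only [weightedAvg, expect_sub_distrib, mul_sub]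

lemma weightedAvg_const_mul (W : D → ℝ) (c : ℝ) (F : D → X → ℝ) :
    weightedAvg W (fun d x => c * F d x) = c * weightedAvg W F := by
  simp only [weightedAvg, ← mul_expect, mul_left_comm _ c]

lemma weightedAvg_mono (hW : ∀ d, 0 ≤ W d) {F F' : D → X → ℝ} (h : ∀ d x, F d x ≤ F' d x) :
    weightedAvg W F ≤ weightedAvg W F' :=
  expect_le_expect fun d _ => mul_le_mul_of_nonneg_left (expect_le_expect fun x _ => h d x) (hW d)

lemma weightedAvg_of_const (hW1 : 𝔼 d, W d = 1) (g : X → ℝ) :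
    weightedAvg W (fun _ x => g x) = 𝔼 x, g x := by
  rw [weightedAvg, ← expect_mul, hW1, one_mul]

lemma abs_weightedAvg_le (hW : ∀ d, 0 ≤ W d) (F : D → X → ℝ) :
    |weightedAvg W F| ≤ weightedAvg W fun d x => |F d x| :=
  (abs_expect_le _ _).trans <| expect_le_expect fun d _ => by
    rw [abs_mul, abs_of_nonneg (hW d)]
    exact mul_le_mul_of_nonneg_left (abs_expect_le _ _) (hW d)

lemma sq_weightedAvg_le [Nonempty X] (hW : ∀ d, 0 ≤ W d) (hW1 : 𝔼 d, W d = 1)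
    (F : D → X → ℝ) : weightedAvg W F ^ 2 ≤ weightedAvg W fun d x => F d x ^ 2 := by
  set m := weightedAvg W F with hm
  have hvar : 0 ≤ weightedAvg W fun d x => (F d x - m) ^ 2 :=
    expect_nonneg fun d _ => mul_nonneg (hW d) (expect_nonneg fun x _ => sq_nonneg _)
  have hexpand : (weightedAvg W fun d x => (F d x - m) ^ 2) =
      (weightedAvg W fun d x => F d x ^ 2) - 2 * m * m + m ^ 2 := by
    simp only [sub_sq, mul_right_comm _ _ m, weightedAvg_add, weightedAvg_sub,
      weightedAvg_const_mul, weightedAvg_of_const hW1, Fintype.expect_const, ← hm]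
  linarith

lemma weightedAvg_translate {G : Type*} [AddCommGroup G] [Fintype G] (W : G → ℝ)
    (F : G → G → ℝ) : weightedAvg W (fun d x => F d (x + d)) = weightedAvg W F := by
  simp only [weightedAvg, expect_translate]

lemma weightedAvg_translate_of_const {G : Type*} [AddCommGroup G] [Fintype G] {W : G → ℝ}
    (hW1 : 𝔼 d, W d = 1) (g : G → ℝ) : weightedAvg W (fun d x => g (x + d)) = 𝔼 x, g x :=
  (weightedAvg_translate W fun _ => g).trans (weightedAvg_of_const hW1 g)

end WeightedAverages

section ThreeAPAverages

variable {G : Type*} [AddCommGroup G] [Fintype G]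

/-- The average of `f x * g (x + d) * h (x + 2d)`, the common difference `d` having weight `W`. -/
noncomputable def threeAPAvg (W f g h : G → ℝ) : ℝ :=
  weightedAvg W fun d x => f x * g (x + d) * h (x + 2 • d)

lemma abs_threeAPAvg_le_expect_abs {W f h : G → ℝ} (hW : ∀ d, 0 ≤ W d) (hW1 : 𝔼 d, W d = 1)
    (hf : ∀ x, |f x| ≤ 1) (hh : ∀ x, |h x| ≤ 1) (g : G → ℝ) :
    |threeAPAvg W f g h| ≤ 𝔼 x, |g x| := by
  have hterm (d x : G) : |f x * g (x + d) * h (x + 2 • d)| ≤ |g (x + d)| := by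
    rw [abs_mul, abs_mul]
    exact (mul_le_of_le_one_right (by positivity) (hh _)).trans
      (mul_le_of_le_one_left (abs_nonneg _) (hf x))
  exact (abs_weightedAvg_le hW _).trans <| (weightedAvg_mono hW hterm).trans_eq <|
    weightedAvg_translate_of_const hW1 fun x => |g x|

lemma expect_character_mul_threeAP (f g h : G → ℝ) (ψ : AddChar G ℂ) :
    𝔼 d, ψ d * ((𝔼 x, f x * g (x + d) * h (x + 2 • d) : ℝ) : ℂ) =
      ∑ χ, fourierCoef h χ * (fourierCoef f (χ + ψ) * fourierCoef g (-(2 • χ + ψ))) := by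
  have hchar (d x : G) (χ : AddChar G ℂ) :
      ψ d * χ (x + 2 • d) = (χ + ψ) (-x) * (2 • χ + ψ) (x + d) := by
    simp only [two_nsmul, AddChar.add_apply, AddChar.map_add_eq_mul]
    have hχ : χ (-x) * χ x = 1 := by
      rw [← AddChar.map_add_eq_mul, neg_add_cancel, AddChar.map_zero_eq_one]
    have hψ : ψ (-x) * ψ x = 1 := by
      rw [← AddChar.map_add_eq_mul, neg_add_cancel, AddChar.map_zero_eq_one]
    linear_combination (-ψ d * χ x * χ d ^ 2) * (ψ (-x) * ψ x * hχ + hψ)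
  have hproduct (χ : AddChar G ℂ) :
      𝔼 d, 𝔼 x, (f x * (χ + ψ) (-x)) * (g (x + d) * (2 • χ + ψ) (x + d)) =
        fourierCoef f (χ + ψ) * fourierCoef g (-(2 • χ + ψ)) := by
    rw [← expect_mul_character, fourierCoef]
    exact expect_expect_mul_translate (fun x => (f x : ℂ) * (χ + ψ) (-x))
      fun x => (g x : ℂ) * (2 • χ + ψ) x
  simp_rw [← hproduct, mul_expect, ← expect_sum_comm]
  refine expect_congr rfl fun d _ => ?_
  rw [Complex.ofReal_expect, mul_expect]
  refine expect_congr rfl fun x _ => ?_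
  rw [Complex.ofReal_mul, ← sum_fourierCoef_mul h, mul_sum, mul_sum]
  refine sum_congr rfl fun χ _ => ?_
  simp only [Complex.ofReal_mul]
  linear_combination (f x * g (x + d) * fourierCoef h χ : ℂ) * hchar d x χ

lemma norm_expect_character_mul_threeAP_le {f g h : G → ℝ} {η : ℝ} (hf : 𝔼 x, f x ^ 2 ≤ 1)
    (hh : 𝔼 x, h x ^ 2 ≤ 1) (hg : ∀ χ, ‖fourierCoef g χ‖ ≤ η) (ψ : AddChar G ℂ) :
    ‖𝔼 d, ψ d * ((𝔼 x, f x * g (x + d) * h (x + 2 • d) : ℝ) : ℂ)‖ ≤ η := by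
  have hη : 0 ≤ η := (norm_nonneg _).trans (hg 0)
  have hshift : ∑ χ, ‖fourierCoef f (χ + ψ)‖ ^ 2 = 𝔼 x, f x ^ 2 := by
    rw [← sum_norm_sq_fourierCoef]
    exact Fintype.sum_equiv (Equiv.addRight ψ) _ _ fun _ => rfl
  rw [expect_character_mul_threeAP]
  calc ‖∑ χ, fourierCoef h χ * (fourierCoef f (χ + ψ) * fourierCoef g (-(2 • χ + ψ)))‖
      ≤ ∑ χ, η * ((‖fourierCoef h χ‖ ^ 2 + ‖fourierCoef f (χ + ψ)‖ ^ 2) / 2) := by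
        refine norm_sum_le_of_le _ fun χ _ => ?_
        rw [norm_mul, norm_mul]
        nlinarith [two_mul_le_add_sq ‖fourierCoef h χ‖ ‖fourierCoef f (χ + ψ)‖,
          mul_le_mul_of_nonneg_left (hg (-(2 • χ + ψ)))
            (mul_nonneg (norm_nonneg (fourierCoef h χ)) (norm_nonneg (fourierCoef f (χ + ψ))))]
    _ = η * ((𝔼 x, h x ^ 2 + 𝔼 x, f x ^ 2) / 2) := by
        rw [← mul_sum, ← sum_div, sum_add_distrib, hshift, sum_norm_sq_fourierCoef]
    _ ≤ η := mul_le_of_le_one_right hη (by linarith)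

lemma abs_threeAPAvg_le {W f g h : G → ℝ} {η : ℝ} (hW : IsPosDefDensity W)
    (hf : 𝔼 x, f x ^ 2 ≤ 1) (hh : 𝔼 x, h x ^ 2 ≤ 1) (hg : ∀ χ, ‖fourierCoef g χ‖ ≤ η) :
    |threeAPAvg W f g h| ≤ W 0 * η := by
  have hexpand : (threeAPAvg W f g h : ℂ) = ∑ ψ, fourierCoef W ψ *
      𝔼 d, ψ d * ((𝔼 x, f x * g (x + d) * h (x + 2 • d) : ℝ) : ℂ) := by
    rw [threeAPAvg, weightedAvg, Complex.ofReal_expect]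
    simp_rw [mul_expect univ _ (fourierCoef W _), ← expect_sum_comm, ← mul_assoc, ← sum_mul,
      sum_fourierCoef_mul, Complex.ofReal_mul]
  calc |threeAPAvg W f g h| = ‖(threeAPAvg W f g h : ℂ)‖ := (Complex.norm_real _).symm
    _ ≤ ∑ ψ, ‖fourierCoef W ψ‖ * η := by
        rw [hexpand]
        refine norm_sum_le_of_le _ fun ψ _ => ?_
        rw [norm_mul]
        exact mul_le_mul_of_nonneg_left (norm_expect_character_mul_threeAP_le hf hh hg ψ)
          (norm_nonneg _)
    _ = W 0 * η := by rw [← sum_mul, hW.sum_norm_fourierCoef]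

end ThreeAPAverages

section MainTerm

variable {G : Type*} [AddCommGroup G] [Fintype G]

lemma weightedAvg_mul_nonneg {W : G → ℝ} (hW : IsPosDefDensity W) (v : G → ℝ) :
    0 ≤ weightedAvg W fun d x => v x * v (x + 2 • d) := by
  have h : 0 ≤ ((𝔼 d, W d * crossCorr v v (2 • d) : ℝ) : ℂ) := by
    rw [expect_mul_crossCorr]
    refine sum_nonneg fun ψ _ => mul_nonneg ?_ (hW.fourierCoef_nonneg _)
    rw [Complex.conj_mul']
    exact_mod_cast sq_nonneg ‖fourierCoef v ψ‖
  exact_mod_cast h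

lemma expect_mul_expect_le_weightedAvg {W f g : G → ℝ} (hW : IsPosDefDensity W)
    (hfg : ∀ ψ, 0 ≤ conj (fourierCoef f ψ) * fourierCoef g ψ) :
    (𝔼 x, f x) * 𝔼 x, g x ≤ weightedAvg W fun d x => f x * g (x + d) := by
  have hsum := expect_mul_crossCorr W f g 1
  have hzero := single_le_sum (f := fun ψ =>
    conj (fourierCoef f ψ) * fourierCoef g ψ * fourierCoef W (-(1 • ψ)))
    (fun ψ _ => mul_nonneg (hfg ψ) (hW.fourierCoef_nonneg _)) (mem_univ 0)
  rw [← hsum] at hzero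
  simp only [neg_zero, fourierCoef_zero, hW.expect_eq_one, Complex.conj_ofReal,
    Complex.ofReal_one, mul_one, one_smul] at hzero
  exact_mod_cast hzero

lemma weightedAvg_sq_sub_translate {W : G → ℝ} (hW : IsPosDefDensity W) (g : G → ℝ) :
    (weightedAvg W fun d x => (g (x + d) - g x) ^ 2) =
      2 * ∑ ψ, ‖fourierCoef g ψ‖ ^ 2 * (1 - ‖fourierCoef W ψ‖) := by
  have hcorr : (weightedAvg W fun d x => g x * g (x + d)) =
      ∑ ψ, ‖fourierCoef g ψ‖ ^ 2 * ‖fourierCoef W ψ‖ := by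
    have h := expect_mul_crossCorr W g g 1
    simp only [one_smul, Complex.conj_mul', hW.fourierCoef_neg] at h
    exact_mod_cast h
  have hexpand (d x : G) : (g (x + d) - g x) ^ 2 =
      g (x + d) ^ 2 + g x ^ 2 - 2 * (g x * g (x + d)) := by ring
  simp_rw [hexpand, weightedAvg_sub, weightedAvg_add, weightedAvg_const_mul,
    weightedAvg_of_const hW.expect_eq_one]
  rw [weightedAvg_translate_of_const hW.expect_eq_one (fun x => g x ^ 2), hcorr,
    ← sum_norm_sq_fourierCoef]
  simp only [mul_sub, mul_one, sum_sub_distrib]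
  ring

lemma sq_sqrt_sub_sqrt_le {a b : ℝ} (ha : 0 ≤ a) (hb : 0 ≤ b) : (√a - √b) ^ 2 ≤ |a - b| := by
  have hfactor : a - b = (√a - √b) * (√a + √b) := by
    rw [mul_comm, ← sq_sub_sq, Real.sq_sqrt ha, Real.sq_sqrt hb]
  have hle : |√a - √b| ≤ √a + √b := by
    rw [abs_le]
    constructor <;> linarith [Real.sqrt_nonneg a, Real.sqrt_nonneg b]
  rw [hfactor, abs_mul, abs_of_nonneg (by positivity : 0 ≤ √a + √b), ← sq_abs, sq]
  exact mul_le_mul_of_nonneg_left hle (abs_nonneg _)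

lemma weightedAvg_abs_sqrt_sub_translate_pow_le {W g : G → ℝ} (hW : IsPosDefDensity W)
    (hg : ∀ x, 0 ≤ g x) :
    (weightedAvg W fun d x => |√(g (x + d)) - √(g x)|) ^ 4 ≤
      2 * ∑ ψ, ‖fourierCoef g ψ‖ ^ 2 * (1 - ‖fourierCoef W ψ‖) := by
  have hsqrt : (weightedAvg W fun d x => |√(g (x + d)) - √(g x)|) ^ 2 ≤
      weightedAvg W fun d x => |g (x + d) - g x| :=
    (sq_weightedAvg_le hW.nonneg hW.expect_eq_one _).trans <| weightedAvg_mono hW.nonneg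
      fun d x => (sq_abs _).trans_le (sq_sqrt_sub_sqrt_le (hg _) (hg _))
  calc (weightedAvg W fun d x => |√(g (x + d)) - √(g x)|) ^ 4
      = ((weightedAvg W fun d x => |√(g (x + d)) - √(g x)|) ^ 2) ^ 2 := by ring
    _ ≤ (weightedAvg W fun d x => |g (x + d) - g x|) ^ 2 := by gcongr
    _ ≤ weightedAvg W fun d x => |g (x + d) - g x| ^ 2 :=
        sq_weightedAvg_le hW.nonneg hW.expect_eq_one _
    _ = 2 * ∑ ψ, ‖fourierCoef g ψ‖ ^ 2 * (1 - ‖fourierCoef W ψ‖) := by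
        simp_rw [sq_abs, weightedAvg_sq_sub_translate hW]

lemma mul_mul_sub_le_mul_sq_mul {p q a b c : ℝ} (hp : |p| ≤ 1) (hq : |q| ≤ 1) (ha : |a| ≤ 1)
    (hb : |b| ≤ 1) : p * a * (q * c) - (|b - a| + |c - b|) ≤ p * b ^ 2 * q := by
  have hpq : |p * q| ≤ 1 := by
    rw [abs_mul]
    exact mul_le_one₀ hp (abs_nonneg q) hq
  have hdiff : |b ^ 2 - a * c| ≤ |b - a| + |c - b| :=
    calc |b ^ 2 - a * c| = |b * (b - a) - a * (c - b)| := by ring_nf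
      _ ≤ |b| * |b - a| + |a| * |c - b| := by
          rw [← abs_mul, ← abs_mul]
          exact abs_sub _ _
      _ ≤ |b - a| + |c - b| := add_le_add (mul_le_of_le_one_left (abs_nonneg _) hb)
          (mul_le_of_le_one_left (abs_nonneg _) ha)
  have hprod : |p * q * (b ^ 2 - a * c)| ≤ |b - a| + |c - b| := by
    rw [abs_mul]
    exact (mul_le_of_le_one_left (abs_nonneg _) hpq).trans hdiff
  linarith [(abs_le.1 hprod).1]

-- When `s` is almost invariant under the translations weighted by `W`, the middle factor `s ^ 2`
-- can be shared between the outer ones, which leaves a positive definite form in `u * s`.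
lemma neg_two_mul_weightedAvg_le_threeAPAvg {W u s : G → ℝ} (hW : IsPosDefDensity W)
    (hu : ∀ x, |u x| ≤ 1) (hs : ∀ x, |s x| ≤ 1) :
    -(2 * weightedAvg W fun d x => |s (x + d) - s x|) ≤ threeAPAvg W u (fun x => s x ^ 2) u := by
  have hpointwise (d x : G) : (u x * s x) * (u (x + 2 • d) * s (x + 2 • d)) -
      (|s (x + d) - s x| + |s (x + d + d) - s (x + d)|) ≤
        u x * s (x + d) ^ 2 * u (x + 2 • d) := by
    rw [add_assoc, ← two_nsmul]
    exact mul_mul_sub_le_mul_sq_mul (hu _) (hu _) (hs _) (hs _)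
  have hle := weightedAvg_mono hW.nonneg hpointwise
  rw [weightedAvg_sub, weightedAvg_add,
    weightedAvg_translate W (fun d x => |s (x + d) - s x|)] at hle
  have hpos := weightedAvg_mul_nonneg hW fun x => u x * s x
  unfold threeAPAvg
  linarith

lemma threeAPAvg_eq_sub_const {W : G → ℝ} (hW1 : 𝔼 d, W d = 1) (f g : G → ℝ) (c : ℝ) :
    threeAPAvg W f g f = threeAPAvg W (fun x => f x - c) g (fun x => f x - c) +
      c * (weightedAvg W fun d x => f x * g (x + d)) +
      c * (weightedAvg W fun d x => g x * f (x + d)) - c ^ 2 * 𝔼 x, g x := by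
  have hexpand (d x : G) : f x * g (x + d) * f (x + 2 • d) =
      (f x - c) * g (x + d) * (f (x + 2 • d) - c) + c * (f x * g (x + d)) +
        c * (g (x + d) * f (x + d + d)) - c ^ 2 * g (x + d) := by
    rw [two_nsmul, ← add_assoc]
    ring
  simp_rw [threeAPAvg, hexpand, weightedAvg_sub, weightedAvg_add, weightedAvg_const_mul]
  rw [weightedAvg_translate_of_const hW1 g,
    weightedAvg_translate W (fun d x => g x * f (x + d))]

end MainTerm

section Regularity

variable {G : Type*} [AddCommGroup G] [Fintype G]

lemma weightedAvg_abs_sqrt_crossCorr_sub_translate_pow_le {W β f : G → ℝ} {δ : ℝ}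
    (hW : IsPosDefDensity W) (hβ : IsPosDefDensity β) (hf0 : ∀ x, 0 ≤ f x) (hf : 𝔼 x, f x ^ 2 ≤ 1)
    (hβW : ∀ ψ, ‖fourierCoef β ψ‖ * (1 - ‖fourierCoef W ψ‖) ≤ δ) :
    (weightedAvg W fun d x => |√(crossCorr β f (x + d)) - √(crossCorr β f x)|) ^ 4 ≤ 2 * δ := by
  have hW1 (ψ : AddChar G ℂ) : 0 ≤ 1 - ‖fourierCoef W ψ‖ :=
    sub_nonneg.2 (hW.norm_fourierCoef_le_one ψ)
  have hδ : 0 ≤ δ := (mul_nonneg (norm_nonneg _) (hW1 0)).trans (hβW 0)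
  have hcoef (ψ : AddChar G ℂ) : ‖fourierCoef (crossCorr β f) ψ‖ ^ 2 * (1 - ‖fourierCoef W ψ‖) ≤
      ‖fourierCoef f ψ‖ ^ 2 * δ :=
    calc ‖fourierCoef (crossCorr β f) ψ‖ ^ 2 * (1 - ‖fourierCoef W ψ‖)
        = ‖fourierCoef f ψ‖ ^ 2 * (‖fourierCoef β ψ‖ ^ 2 * (1 - ‖fourierCoef W ψ‖)) := by
          rw [hβ.fourierCoef_crossCorr, norm_mul, Complex.norm_real, norm_norm]
          ring
      _ ≤ ‖fourierCoef f ψ‖ ^ 2 * (‖fourierCoef β ψ‖ * (1 - ‖fourierCoef W ψ‖)) := by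
          gcongr
          · exact hW1 ψ
          · exact pow_le_of_le_one (norm_nonneg _) (hβ.norm_fourierCoef_le_one ψ) two_ne_zero
      _ ≤ ‖fourierCoef f ψ‖ ^ 2 * δ := by
          gcongr
          exact hβW ψ
  have hg (x : G) : 0 ≤ crossCorr β f x := expect_nonneg fun y _ => mul_nonneg (hβ.nonneg y) (hf0 _)
  refine (weightedAvg_abs_sqrt_sub_translate_pow_le hW hg).trans ?_
  gcongr
  calc ∑ ψ, ‖fourierCoef (crossCorr β f) ψ‖ ^ 2 * (1 - ‖fourierCoef W ψ‖)
      ≤ ∑ ψ, ‖fourierCoef f ψ‖ ^ 2 * δ := sum_le_sum fun ψ _ => hcoef ψ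
    _ = (𝔼 x, f x ^ 2) * δ := by rw [← sum_mul, sum_norm_sq_fourierCoef]
    _ ≤ δ := mul_le_of_le_one_left hδ hf

lemma sq_expect_le_weightedAvg_mul_crossCorr {W β : G → ℝ} (hW : IsPosDefDensity W)
    (hβ : IsPosDefDensity β) (f : G → ℝ) :
    (𝔼 x, f x) ^ 2 ≤ weightedAvg W fun d x => f x * crossCorr β f (x + d) := by
  have h := expect_mul_expect_le_weightedAvg hW (f := f) (g := crossCorr β f) fun ψ => by
    rw [hβ.fourierCoef_crossCorr, mul_left_comm, Complex.conj_mul']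
    exact_mod_cast (by positivity : 0 ≤ ‖fourierCoef β ψ‖ * ‖fourierCoef f ψ‖ ^ 2)
  rwa [expect_crossCorr, hβ.expect_eq_one, one_mul, ← sq] at h

lemma sq_expect_le_weightedAvg_crossCorr_mul {W β : G → ℝ} (hW : IsPosDefDensity W)
    (hβ : IsPosDefDensity β) (f : G → ℝ) :
    (𝔼 x, f x) ^ 2 ≤ weightedAvg W fun d x => crossCorr β f x * f (x + d) := by
  have h := expect_mul_expect_le_weightedAvg hW (f := crossCorr β f) (g := f) fun ψ => by
    rw [hβ.fourierCoef_crossCorr, map_mul, Complex.conj_ofReal, mul_assoc, Complex.conj_mul']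
    exact_mod_cast (by positivity : 0 ≤ ‖fourierCoef β ψ‖ * ‖fourierCoef f ψ‖ ^ 2)
  rwa [expect_crossCorr, hβ.expect_eq_one, one_mul, ← sq] at h

lemma cube_sub_le_threeAPAvg_crossCorr {W β f : G → ℝ} {δ t : ℝ} (hW : IsPosDefDensity W)
    (hβ : IsPosDefDensity β) (hf : ∀ x, f x ∈ Set.Icc 0 1)
    (hβW : ∀ ψ, ‖fourierCoef β ψ‖ * (1 - ‖fourierCoef W ψ‖) ≤ δ) (ht : 0 ≤ t)
    (hδt : 2 * δ ≤ t ^ 4) :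
    (𝔼 x, f x) ^ 3 - 2 * t ≤ threeAPAvg W f (crossCorr β f) f := by
  set g := crossCorr β f
  set a := 𝔼 x, f x
  have hg (x : G) : g x ∈ Set.Icc 0 1 := hβ.crossCorr_mem_Icc hf x
  have ha0 : 0 ≤ a := expect_nonneg fun x _ => (hf x).1
  have ha1 : a ≤ 1 := expect_le univ_nonempty fun x _ => (hf x).2
  have hga : 𝔼 x, g x = a := by rw [expect_crossCorr, hβ.expect_eq_one, one_mul]
  have hinvariant : (weightedAvg W fun d x => |√(g (x + d)) - √(g x)|) ≤ t :=
    le_of_pow_le_pow_left₀ four_ne_zero ht <| hδt.trans' <|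
      weightedAvg_abs_sqrt_crossCorr_sub_translate_pow_le hW hβ (fun x => (hf x).1)
        (expect_le univ_nonempty fun x _ => pow_le_one₀ (hf x).1 (hf x).2) hβW
  have hbalanced : -(2 * t) ≤ threeAPAvg W (fun x => f x - a) g (fun x => f x - a) := by
    have h := neg_two_mul_weightedAvg_le_threeAPAvg hW (u := fun x => f x - a)
      (s := fun x => √(g x))
      (fun x => abs_le.2 ⟨by linarith [(hf x).1], by linarith [(hf x).2]⟩)
      (fun x => by
        rw [abs_of_nonneg (Real.sqrt_nonneg _)]
        exact Real.sqrt_le_one.2 (hg x).2)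
    simp only [Real.sq_sqrt (hg _).1] at h
    linarith
  rw [threeAPAvg_eq_sub_const hW.expect_eq_one f g a, hga]
  linarith [mul_le_mul_of_nonneg_left (sq_expect_le_weightedAvg_mul_crossCorr hW hβ f) ha0,
    mul_le_mul_of_nonneg_left (sq_expect_le_weightedAvg_crossCorr_mul hW hβ f) ha0]

lemma exists_scales {δ θ : ℝ} (hδ : 0 < δ) (hθ : 0 < θ) :
    ∃ M : ℝ, ∀ (G : Type*) [AddCommGroup G] [Fintype G] (f : G → ℝ), (∀ x, |f x| ≤ 1) →
      ∃ β W β' : G → ℝ, IsPosDefDensity β ∧ IsPosDefDensity W ∧ IsPosDefDensity β' ∧ W 0 ≤ M ∧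
        IsRefinement δ f β W ∧ IsRefinement δ f W β' ∧
        ∑ ψ, ‖fourierCoef f ψ‖ ^ 2 * (‖fourierCoef β' ψ‖ - ‖fourierCoef β ψ‖) ^ 2 ≤ θ + 4 * δ := by
  obtain ⟨M, hM⟩ := exists_refining_sequence hδ
  obtain ⟨K, hK⟩ := exists_nat_one_div_lt hθ
  obtain ⟨M', hM'⟩ := ((range (2 * (K + 1))).image M).exists_le
  refine ⟨M', fun G _ _ f hf => ?_⟩
  obtain ⟨β, hβ⟩ := hM G f hf
  have hdens (n : ℕ) := (hβ n).1
  have hrefine (n : ℕ) := (hβ n).2.2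
  obtain ⟨k, hkK, hk⟩ := exists_weighted_sum_sq_sub_le (s := univ) (δ := 2 * δ)
    (c := fun ψ => ‖fourierCoef f ψ‖ ^ 2) (b := fun k ψ => ‖fourierCoef (β (2 * k)) ψ‖)
    K.succ_pos (by positivity) (fun ψ => sq_nonneg _)
    (by
      rw [sum_norm_sq_fourierCoef]
      exact expect_le univ_nonempty fun x _ => (sq_le_one_iff_abs_le_one _).2 (hf x))
    (fun k ψ => ⟨norm_nonneg _, (hdens _).norm_fourierCoef_le_one ψ⟩)
    (fun k ψ => by
      have h₁ := (hrefine (2 * k)).norm_fourierCoef_sub_le (hdens _) (hdens _) ψ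
      have h₂ := (hrefine (2 * k + 1)).norm_fourierCoef_sub_le (hdens _) (hdens _) ψ
      rw [mul_add_one]
      linarith)
  refine ⟨β (2 * k), β (2 * k + 1), β (2 * k + 2), hdens _, hdens _, hdens _,
    (hβ _).2.1.trans (hM' _ (mem_image_of_mem M (mem_range.2 (by lia)))), hrefine _, hrefine _, ?_⟩
  push_cast at hk
  rw [mul_add_one] at hk
  linarith

lemma sq_expect_abs_le {X : Type*} [Fintype X] [Nonempty X] (h : X → ℝ) :
    (𝔼 x, |h x|) ^ 2 ≤ 𝔼 x, h x ^ 2 := by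
  simpa using expect_mul_sq_le_sq_mul_sq univ (fun x => |h x|) 1

lemma sq_expect_abs_crossCorr_sub_le {β β' : G → ℝ} (hβ : IsPosDefDensity β)
    (hβ' : IsPosDefDensity β') (f : G → ℝ) :
    (𝔼 x, |crossCorr β' f x - crossCorr β f x|) ^ 2 ≤
      ∑ ψ, ‖fourierCoef f ψ‖ ^ 2 * (‖fourierCoef β' ψ‖ - ‖fourierCoef β ψ‖) ^ 2 := by
  refine (sq_expect_abs_le _).trans_eq ?_
  rw [← sum_norm_sq_fourierCoef]
  refine sum_congr rfl fun ψ _ => ?_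
  rw [fourierCoef_sub, hβ.fourierCoef_crossCorr, hβ'.fourierCoef_crossCorr, ← sub_mul,
    ← Complex.ofReal_sub, norm_mul, mul_pow, Complex.norm_real, Real.norm_eq_abs, sq_abs, mul_comm]

lemma abs_threeAPAvg_sub_crossCorr_le {W β f : G → ℝ} {δ : ℝ} (hW : IsPosDefDensity W)
    (hβ : IsPosDefDensity β) (hWβ : IsRefinement δ f W β)
    (hf : 𝔼 x, f x ^ 2 ≤ 1) :
    |threeAPAvg W f (fun x => f x - crossCorr β f x) f| ≤ δ := by
  have hW0 : 0 < W 0 := one_pos.trans_le hW.one_le_apply_zero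
  refine (abs_threeAPAvg_le hW hf hf (η := δ / W 0) fun ψ => ?_).trans_eq
    (mul_div_cancel₀ δ hW0.ne')
  have hcoef : fourierCoef (fun x => f x - crossCorr β f x) ψ =
      fourierCoef f ψ * ((1 - ‖fourierCoef β ψ‖ : ℝ) : ℂ) := by
    rw [fourierCoef_sub, hβ.fourierCoef_crossCorr]
    push_cast
    ring
  rw [hcoef, norm_mul, Complex.norm_real,
    Real.norm_of_nonneg (sub_nonneg.2 (hβ.norm_fourierCoef_le_one ψ)), le_div_iff₀' hW0]
  exact hWβ.apply_zero_mul_le hβ ψ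

lemma threeAPAvg_sub (W f g g' h : G → ℝ) :
    threeAPAvg W f (fun x => g x - g' x) h = threeAPAvg W f g h - threeAPAvg W f g' h := by
  simp only [threeAPAvg, mul_sub, sub_mul, weightedAvg_sub]

theorem exists_weight_cube_sub_le_threeAPAvg {ε : ℝ} (hε : 0 < ε) :
    ∃ M : ℝ, ∀ (G : Type*) [AddCommGroup G] [Fintype G] (f : G → ℝ), (∀ x, f x ∈ Set.Icc 0 1) →
      ∃ W : G → ℝ, IsPosDefDensity W ∧ W 0 ≤ M ∧ (𝔼 x, f x) ^ 3 - ε ≤ threeAPAvg W f f f := by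
  set t := min 1 (ε / 4)
  have ht : 0 < t := by positivity
  have hδ : 0 < t ^ 4 / 8 := by positivity
  obtain ⟨M, hM⟩ := exists_scales hδ (θ := t ^ 2 / 2) (by positivity)
  refine ⟨M, fun G _ _ f hf => ?_⟩
  have hf1 (x : G) : |f x| ≤ 1 := abs_le.2 ⟨by linarith [(hf x).1], (hf x).2⟩
  obtain ⟨β, W, β', hβ, hW, hβ', hWM, hβW, hWβ', hclose⟩ := hM G f hf1
  refine ⟨W, hW, hWM, ?_⟩
  have ht_sq : t ^ 4 ≤ t ^ 2 := pow_le_pow_of_le_one ht.le (min_le_left _ _) (by norm_num)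
  have ht_four : t ^ 4 ≤ t := pow_le_of_le_one ht.le (min_le_left _ _) (by norm_num)
  have huniform := abs_threeAPAvg_sub_crossCorr_le hW hβ' hWβ' <|
    expect_le univ_nonempty fun x _ => (sq_le_one_iff_abs_le_one _).2 (hf1 x)
  have hsmall : |threeAPAvg W f (fun x => crossCorr β' f x - crossCorr β f x) f| ≤ t := by
    refine (abs_threeAPAvg_le_expect_abs hW.nonneg hW.expect_eq_one hf1 hf1 _).trans ?_
    refine le_of_sq_le_sq ?_ ht.le
    linarith [sq_expect_abs_crossCorr_sub_le hβ hβ' f]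
  have hmain := cube_sub_le_threeAPAvg_crossCorr hW hβ hf
    (hβW.norm_fourierCoef_mul_le hβ hW) ht.le (by linarith)
  rw [threeAPAvg_sub] at huniform hsmall
  linarith [(abs_le.1 huniform).1, (abs_le.1 hsmall).1, min_le_right 1 (ε / 4)]

end Regularity

lemma expect_mul_le_add_div_card {X : Type*} [Fintype X] {W F : X → ℝ} {a : X} {κ : ℝ}
    (hW : ∀ x, 0 ≤ W x) (hW1 : 𝔼 x, W x = 1) (hκ : 0 ≤ κ) (hFa : F a ≤ 1)
    (hF : ∀ x, x ≠ a → F x ≤ κ) : 𝔼 x, W x * F x ≤ κ + W a / Fintype.card X := by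
  classical
  have hpointwise (x : X) : W x * F x ≤ W x * κ + if x = a then W a else 0 := by
    split_ifs with hx
    · rw [hx]
      nlinarith [hW a, mul_nonneg (hW a) hκ]
    · rw [add_zero]
      exact mul_le_mul_of_nonneg_left (hF x hx) (hW x)
  calc 𝔼 x, W x * F x ≤ 𝔼 x, (W x * κ + if x = a then W a else 0) :=
        expect_le_expect fun x _ => hpointwise x
    _ = κ + W a / Fintype.card X := by
        rw [expect_add_distrib, ← expect_mul, hW1, one_mul,
          Fintype.expect_eq_sum_div_card fun x => if x = a then W a else 0,
          sum_ite_eq' univ a fun _ => W a, if_pos (mem_univ a)]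

lemma threeAPAvg_indicator {G : Type*} [AddCommGroup G] [Fintype G] [DecidableEq G] (W : G → ℝ)
    (A : Finset G) : (threeAPAvg W (fun x => if x ∈ A then 1 else 0)
      (fun x => if x ∈ A then 1 else 0) fun x => if x ∈ A then 1 else 0) =
        𝔼 d, W d * (numThreeAP A d / Fintype.card G) := by
  refine expect_congr rfl fun d _ => ?_
  have hfilter : A.filter (fun x => x + d ∈ A ∧ x + 2 • d ∈ A) =
      univ.filter fun x => (x ∈ A ∧ x + d ∈ A) ∧ x + 2 • d ∈ A := by
    ext x
    simp [and_assoc]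
  have hterm (x : G) : ((if x ∈ A then 1 else 0) * (if x + d ∈ A then 1 else 0) *
      if x + 2 • d ∈ A then 1 else 0 : ℝ) =
        if (x ∈ A ∧ x + d ∈ A) ∧ x + 2 • d ∈ A then 1 else 0 := by
    simp only [ite_and, ite_mul, one_mul, zero_mul]
  simp_rw [hterm]
  rw [Fintype.expect_eq_sum_div_card, sum_boole, numThreeAP, hfilter]

theorem theorem1p8_general (α ε : ℝ) (hε : 0 < ε) :
    ∃ N₀ : ℕ, ∀ (G : Type*) [AddCommGroup G] [Fintype G] [DecidableEq G],
      N₀ < Fintype.card G →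
      ∀ A : Finset G, (A.card : ℝ) = α * (Fintype.card G : ℝ) →
        ∃ d : G, d ≠ 0 ∧
          (α ^ 3 - ε) * (Fintype.card G : ℝ) ≤ (numThreeAP A d : ℝ) := by
  obtain ⟨M, hM⟩ := exists_weight_cube_sub_le_threeAPAvg (half_pos hε)
  refine ⟨max 1 ⌈2 * M / ε⌉₊, fun G _ _ _ hN A hA => ?_⟩
  obtain ⟨hN1, hNM⟩ := max_lt_iff.1 hN
  have hNpos : 0 < (Fintype.card G : ℝ) := by exact_mod_cast one_pos.trans hN1
  obtain ⟨W, hW, hWM, hcount⟩ := hM G (fun x => if x ∈ A then 1 else 0) fun x => by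
    split_ifs <;> simp
  have hdensity : (𝔼 x, if x ∈ A then 1 else 0 : ℝ) = α := by
    rw [Fintype.expect_eq_sum_div_card, sum_boole, filter_mem_eq_inter, univ_inter, hA,
      mul_div_cancel_right₀ _ hNpos.ne']
  by_contra! hfew
  have hfew' (d : G) (hd : d ≠ 0) : (numThreeAP A d : ℝ) / Fintype.card G ≤ α ^ 3 - ε :=
    ((div_lt_iff₀ hNpos).2 (hfew d hd)).le
  have := Fintype.one_lt_card_iff_nontrivial.1 hN1
  obtain ⟨d, hd⟩ := exists_ne (0 : G)
  have hκ : 0 ≤ α ^ 3 - ε := (hfew' d hd).trans' (by positivity)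
  have hle := expect_mul_le_add_div_card hW.nonneg hW.expect_eq_one hκ
    ((div_le_one hNpos).2 (mod_cast card_le_univ _)) hfew'
  have hWN : W 0 / Fintype.card G < ε / 2 := by
    rw [div_lt_iff₀ hNpos]
    linarith [(div_lt_iff₀ hε).1 (Nat.lt_of_ceil_lt hNM)]
  rw [threeAPAvg_indicator, hdensity] at hcount
  linarith

theorem theorem1p8 (α ε : ℝ) (hα : 0 < α) (hε : 0 < ε) :
    ∃ N₀ : ℕ, ∀ (G : Type*) [AddCommGroup G] [Fintype G] [DecidableEq G],
      N₀ < Fintype.card G → Odd (Fintype.card G) →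
      ∀ A : Finset G, (A.card : ℝ) = α * (Fintype.card G : ℝ) →
        ∃ d : G, d ≠ 0 ∧
          (α ^ 3 - ε) * (Fintype.card G : ℝ) ≤ (numThreeAP A d : ℝ) :=
  (theorem1p8_general α ε hε).imp fun _ h G _ _ _ hN _ => h G hN
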